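/- Let $\eta>2$, $\lambda>0$, $p_t>0$, $\theta_{\rm ack}>0$ and $R_o>0$. A typical transmitter is located at the origin $x_o=0\in\mathbb R^2$ and its paired receiver at a point $y_o\in\mathbb R^2$ with $\|y_o-x_o\|=R_o$. The interfering receivers form a homogeneous Poisson point process $\Psi=\{y_i\}_{i\ge 0}$ of intensity $\lambda$ on $\mathbb R^2$ (in a measurable enumeration), and all receivers transmit feedback with the same power $p_t$. The channel power gains $h_o$ (from $y_o$) and $h_i$ (from $y_i$) are exponentially distributed with mean $1$ (Rayleigh fading); $h_o,h_0,h_1,\dots$ are independent of each other and (jointly) of the locations $(y_i)_{i\ge 0}$. The power-law path loss has exponent $\eta$. Then the feedback (ACK/NACK) success probability $$p_{\rm ack}=\mathbb P\left\{\frac{p_t\,h_o\,\|y_o-x_o\|^{-\eta}}{\sum_{y_i\in\Psi\setminus\{y_o\}}p_t\,h_i\,\|y_i-x_o\|^{-\eta}}\ \ge\ \theta_{\rm ack}\right\}$$ is given by $$p_{\rm ack}=\exp\left[\frac{-2\pi^2\,\lambda\,R_o^2\,\theta_{\rm ack}^{2/\eta}}{\eta\,\sin(2\pi/\eta)}\right].$$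 -/

import Mathlib

open MeasureTheory ProbabilityTheory
open scoped ENNReal NNReal

noncomputable section

/-- The Euclidean plane in which the devices are located. -/
abbrev Plane : Type := EuclideanSpace ℝ (Fin 2)

/-- The random measure `N` on `E` is a Poisson point process (given as its counting measure) with
intensity measure `Λ`: the number of points `N B` in a measurable set `B` with `Λ B < ∞` has the
Poisson law of mean `Λ B`, and the numbers of points in finitely many pairwise disjoint such sets
are independent. -/
structure IsPoissonPointProcess {Ω E : Type*} [MeasurableSpace Ω] [MeasurableSpace E]
    (N : Ω → Measure E) (Λ : Measure E) (P : Measure Ω) : Prop where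
  hasLaw_count : ∀ B : Set E, MeasurableSet B → Λ B ≠ ∞ →
    HasLaw (fun ω => N ω B)
      ((poissonMeasure (Λ B).toNNReal).map (fun k : ℕ => (k : ℝ≥0∞))) P
  iIndepFun_count : ∀ (n : ℕ) (B : Fin n → Set E), (∀ j, MeasurableSet (B j)) →
    (∀ j, Λ (B j) ≠ ∞) → Pairwise (fun j k => Disjoint (B j) (B k)) →
    iIndepFun (fun j ω => N ω (B j)) P

/-- The counting measure of the points `y 0 ω, y 1 ω, …`. -/
def countingProcess {Ω E : Type*} [MeasurableSpace E] (y : ℕ → Ω → E) (ω : Ω) : Measure E :=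
  Measure.sum fun i => Measure.dirac (y i ω)

/-- The power received at `x` from a device at `y` which transmits with power `p`, when the channel
has power gain `g` and the path-loss exponent is `η`; that is `p * g * ‖y - x‖ ^ (-η)`, which is
`∞` when `y = x` and `p * g > 0`. -/
def receivedPower (η p g : ℝ) (y x : Plane) : ℝ≥0∞ :=
  ENNReal.ofReal (p * g) * ‖y - x‖ₑ ^ (-η)

/-- The feedback interference at the transmitter `x₀`: the total power received from the points
`y i ω` other than the paired receiver `y₀`, all of which transmit with power `p`. -/
def feedbackInterference {Ω : Type*} (η p : ℝ) (x₀ y₀ : Plane) (y : ℕ → Ω → Plane)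
    (h : ℕ → Ω → ℝ) (ω : Ω) : ℝ≥0∞ :=
  ∑' i : {i : ℕ // y i ω ≠ y₀}, receivedPower η p (h i ω) (y i ω) x₀

/-- The signal-to-interference ratio of the feedback sent by `y₀` to `x₀`. -/
def feedbackSIR {Ω : Type*} (η p : ℝ) (x₀ y₀ : Plane) (y : ℕ → Ω → Plane)
    (h₀ : Ω → ℝ) (h : ℕ → Ω → ℝ) (ω : Ω) : ℝ≥0∞ :=
  receivedPower η p (h₀ ω) y₀ x₀ / feedbackInterference η p x₀ y₀ y h ω

/-- The feedback success probability: the probability that the feedback SIR is at least `θ`. -/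
def feedbackSuccessProbability {Ω : Type*} [MeasurableSpace Ω] (P : Measure Ω) (η p θ : ℝ)
    (x₀ y₀ : Plane) (y : ℕ → Ω → Plane) (h₀ : Ω → ℝ) (h : ℕ → Ω → ℝ) : ℝ :=
  P.real {ω | ENNReal.ofReal θ ≤ feedbackSIR η p x₀ y₀ y h₀ h ω}

end

/-! After cancelling powers, success means `J ≤ h₀` with `J = ∑ h i * w (y i)` and `w x = θ R₀^η
‖x‖^(-η)`. The gain `h₀` is exponential and independent of `J`, so the probability is the Laplace
transform `E[exp (-J)]` (`measure_le_ofReal_of_indepFun`). Averaging over the gains with the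
locations frozen turns each summand into a factor `1 / (1 + w (y i))`
(`lintegral_expNeg_tsum_exponential`), and the Laplace functional of the Poisson process turns the
product into `exp (-lam ∫ (1 - 1 / (1 + w)))` (`laplace_functional`). Tonelli and Euler's reflection
formula evaluate that integral (`lintegral_one_sub_inv_one_add_pathLoss`). Working in `[0, ∞]` with
`exp (-∞) = 0` avoids proving that the interference is finite. -/

/-! ### The function `x ↦ exp (-x)` on `[0, ∞]` -/

/-- The function `x ↦ exp (-x)` on `[0, ∞]`, with value `0` at `∞`. -/
noncomputable def expNeg (x : ℝ≥0∞) : ℝ≥0∞ := (EReal.exp x)⁻¹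

lemma continuous_expNeg : Continuous expNeg :=
  continuous_inv.comp (ENNReal.continuous_exp.comp continuous_coe_ennreal_ereal)

lemma measurable_expNeg : Measurable expNeg := continuous_expNeg.measurable

@[simp] lemma expNeg_zero : expNeg 0 = 1 := by simp [expNeg]

@[simp] lemma expNeg_top : expNeg ∞ = 0 := by simp [expNeg]

lemma expNeg_le_one (x : ℝ≥0∞) : expNeg x ≤ 1 := by
  simpa [expNeg, ENNReal.inv_le_one] using EReal.coe_ennreal_nonneg x

lemma expNeg_ne_top (x : ℝ≥0∞) : expNeg x ≠ ∞ :=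
  ((expNeg_le_one x).trans_lt ENNReal.one_lt_top).ne

lemma expNeg_antitone : Antitone expNeg := fun x y hxy => by
  simpa [expNeg] using hxy

lemma expNeg_add (x y : ℝ≥0∞) : expNeg (x + y) = expNeg x * expNeg y := by
  rw [expNeg, expNeg, expNeg, EReal.coe_ennreal_add, EReal.exp_add, ENNReal.mul_inv]
  · left; simp
  · right; simp

lemma expNeg_sum {ι : Type*} (s : Finset ι) (f : ι → ℝ≥0∞) :
    expNeg (∑ i ∈ s, f i) = ∏ i ∈ s, expNeg (f i) := by
  classical
  induction s using Finset.induction_on with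
  | empty => simp
  | insert a s ha ih => rw [Finset.sum_insert ha, Finset.prod_insert ha, expNeg_add, ih]

lemma expNeg_mul_natCast (x : ℝ≥0∞) (n : ℕ) : expNeg (x * n) = expNeg x ^ n := by
  rw [mul_comm, ← nsmul_eq_mul, ← Finset.card_range n, ← Finset.sum_const, expNeg_sum]
  simp

lemma expNeg_ofReal {x : ℝ} (hx : 0 ≤ x) :
    expNeg (ENNReal.ofReal x) = ENNReal.ofReal (Real.exp (-x)) := by
  rw [expNeg, EReal.coe_ennreal_ofReal, max_eq_left hx, EReal.exp_coe, Real.exp_neg,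
    ENNReal.ofReal_inv_of_pos (Real.exp_pos _)]

/-- The function `z ↦ -log z` on `[0, 1]`, with value `∞` at `0`. -/
noncomputable def negLog (z : ℝ≥0∞) : ℝ≥0∞ := (ENNReal.log z⁻¹).toENNReal

lemma measurable_negLog : Measurable negLog := by
  unfold negLog
  fun_prop

lemma expNeg_negLog {z : ℝ≥0∞} (hz : z ≤ 1) : expNeg (negLog z) = z := by
  have h : 0 ≤ ENNReal.log z⁻¹ := by
    rw [← ENNReal.log_one]
    exact ENNReal.log_monotone (ENNReal.one_le_inv.2 hz)
  rw [expNeg, negLog, EReal.coe_toENNReal h, ENNReal.exp_log, inv_inv]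

/-! ### Laplace transforms of the exponential and Poisson laws -/

lemma lintegral_exp_neg_mul_Ioi {b : ℝ} (hb : 0 < b) (c : ℝ) :
    ∫⁻ t in Set.Ioi c, ENNReal.ofReal (Real.exp (-b * t)) =
      ENNReal.ofReal (Real.exp (-b * c) / b) := by
  have hb' : -b < 0 := by linarith
  rw [← ofReal_integral_eq_lintegral_ofReal (integrableOn_exp_mul_Ioi hb' c)
    (Filter.Eventually.of_forall fun t => (Real.exp_pos _).le), integral_exp_mul_Ioi hb']
  congr 1
  field_simp

lemma lintegral_expMeasure_one {f : ℝ → ℝ≥0∞} (hf : Measurable f) :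
    ∫⁻ t, f t ∂expMeasure 1 =
      ∫⁻ t in Set.Ioi 0, f t * ENNReal.ofReal (Real.exp (-t)) := by
  have hm : Measurable (exponentialPDF 1) :=
    (measurable_exponentialPDFReal 1).ennreal_ofReal
  have h : expMeasure 1 = volume.withDensity (exponentialPDF 1) := rfl
  rw [h, lintegral_withDensity_eq_lintegral_mul _ hm hf,
    setLIntegral_congr Ioi_ae_eq_Ici,
    ← lintegral_indicator measurableSet_Ici]
  refine lintegral_congr fun t => ?_
  by_cases ht : 0 ≤ t
  · simp [exponentialPDF_of_nonneg ht, ht, mul_comm]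
  · simp [exponentialPDF_of_neg (not_le.1 ht), ht]

lemma ae_pos_expMeasure_one : ∀ᵐ t ∂expMeasure 1, 0 < t := by
  rw [ae_iff]
  simp only [not_lt]
  change expMeasure 1 (Set.Iic 0) = 0
  rw [← lintegral_indicator_one measurableSet_Iic,
    lintegral_expMeasure_one (measurable_one.indicator measurableSet_Iic)]
  refine (setLIntegral_congr_fun measurableSet_Ioi (g := 0) fun t ht => ?_).trans (by simp)
  simp [Set.mem_Ioi.1 ht]

lemma expMeasure_one_le_ofReal (x : ℝ≥0∞) :
    expMeasure 1 {t | x ≤ ENNReal.ofReal t} = expNeg x := by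
  have : IsProbabilityMeasure (expMeasure 1) := isProbabilityMeasure_expMeasure one_pos
  induction x with
  | top => simp
  | coe x =>
    rcases eq_or_ne x 0 with rfl | hx
    · simp
    have hx0 : (0 : ℝ) < x := by positivity
    have hset : {t : ℝ | (x : ℝ≥0∞) ≤ ENNReal.ofReal t} = Set.Ici (x : ℝ) := by
      ext t
      rw [Set.mem_ofPred_eq, ← ENNReal.ofReal_coe_nnreal, Set.mem_Ici,
        ENNReal.ofReal_le_ofReal_iff']
      constructor
      · rintro (h | h)
        · exact h
        · linarith
      · exact Or.inl
    rw [hset, ← lintegral_indicator_one measurableSet_Ici,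
      lintegral_expMeasure_one (measurable_one.indicator measurableSet_Ici),
      ← ENNReal.ofReal_coe_nnreal, expNeg_ofReal hx0.le]
    calc
      _ = ∫⁻ t in Set.Ioi 0, (Set.Ici (x : ℝ)).indicator
            (fun t => ENNReal.ofReal (Real.exp (-1 * t))) t := by
        refine lintegral_congr fun t => ?_
        by_cases h : (x : ℝ) ≤ t <;> simp [h]
      _ = ∫⁻ t in Set.Ioi (x : ℝ), ENNReal.ofReal (Real.exp (-1 * t)) := by
        rw [lintegral_indicator measurableSet_Ici, Measure.restrict_restrict measurableSet_Ici,
          Set.inter_eq_left.2 (Set.Ici_subset_Ioi.2 hx0)]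
        exact (setLIntegral_congr Ioi_ae_eq_Ici).symm
      _ = _ := by
        rw [lintegral_exp_neg_mul_Ioi one_pos]
        simp

lemma lintegral_expNeg_mul_expMeasure_one (a : ℝ≥0∞) :
    ∫⁻ t, expNeg (ENNReal.ofReal t * a) ∂expMeasure 1 = (1 + a)⁻¹ := by
  induction a with
  -- An infinite path gain kills the integrand unless `t = 0`, where `0 * ∞ = 0`; that is a null
  -- event.
  | top =>
    rw [lintegral_congr_ae (g := 0)]
    · simp
    · filter_upwards [ae_pos_expMeasure_one] with t ht
      simp [ENNReal.mul_top, ht]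
  | coe a =>
    rw [lintegral_expMeasure_one (f := fun t => expNeg (ENNReal.ofReal t * a))
      (measurable_expNeg.comp (by fun_prop))]
    calc
      _ = ∫⁻ t in Set.Ioi 0, ENNReal.ofReal (Real.exp (-(1 + a) * t)) := by
        refine setLIntegral_congr_fun measurableSet_Ioi fun t ht => ?_
        have ht : 0 < t := ht
        rw [← ENNReal.ofReal_coe_nnreal, ← ENNReal.ofReal_mul ht.le,
          expNeg_ofReal (by positivity), ← ENNReal.ofReal_mul (Real.exp_pos _).le, ← Real.exp_add]
        ring_nf
      _ = _ := by
        rw [lintegral_exp_neg_mul_Ioi (by positivity)]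
        rw [mul_zero, Real.exp_zero, one_div, ENNReal.ofReal_inv_of_pos (by positivity),
          ENNReal.ofReal_add zero_le_one a.coe_nonneg]
        simp

/-- This is the Poisson generating function `E[z^k] = exp (-(1 - z) m)` at `z = expNeg v`, summed as
an exponential series. -/
lemma lintegral_expNeg_mul_poissonMeasure (v : ℝ≥0∞) (m : ℝ≥0) :
    ∫⁻ k, expNeg (v * (k : ℝ≥0∞)) ∂poissonMeasure m = expNeg ((1 - expNeg v) * m) := by
  obtain ⟨z, hz⟩ : ∃ z : ℝ≥0, (z : ℝ≥0∞) = expNeg v :=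
    ⟨_, ENNReal.coe_toNNReal (expNeg_ne_top v)⟩
  have hz1 : z ≤ 1 := by simpa [← hz] using expNeg_le_one v
  have hz1' : (z : ℝ) ≤ 1 := hz1
  have hR : (1 - expNeg v) * m = ENNReal.ofReal ((1 - z) * m) := by
    rw [← hz, ENNReal.ofReal_mul (by linarith), ENNReal.ofReal_sub _ z.coe_nonneg]
    simp
  rw [hR, expNeg_ofReal (mul_nonneg (by linarith) m.coe_nonneg), poissonMeasure,
    lintegral_sum_measure]
  simp_rw [lintegral_smul_measure, lintegral_dirac, expNeg_mul_natCast, ← hz, smul_eq_mul,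
    ← ENNReal.ofReal_coe_nnreal (p := z), ← ENNReal.ofReal_pow z.coe_nonneg]
  have hs : HasSum (fun n : ℕ => Real.exp (-m) * (((z * m : ℝ)) ^ n / n.factorial))
      (Real.exp (-m) * Real.exp (z * m)) := by
    have := (NormedSpace.expSeries_div_hasSum_exp (z * m : ℝ)).mul_left (Real.exp (-m))
    rwa [← Real.exp_eq_exp_ℝ] at this
  have hterm (n : ℕ) : ENNReal.ofReal (Real.exp (-m) * m ^ n / n.factorial) *
      ENNReal.ofReal ((z : ℝ) ^ n) =
      ENNReal.ofReal (Real.exp (-m) * (((z * m : ℝ)) ^ n / n.factorial)) := by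
    rw [← ENNReal.ofReal_mul (by positivity)]
    congr 1
    rw [mul_pow]
    ring
  simp_rw [hterm]
  rw [← ENNReal.ofReal_tsum_of_nonneg (fun n => by positivity) hs.summable, hs.tsum_eq,
    ← Real.exp_add]
  congr 2
  ring

/-! ### Independence and Lebesgue integrals -/

lemma ProbabilityTheory.IndepFun.lintegral_comp_prodMk {Ω α β : Type*} [MeasurableSpace Ω]
    [MeasurableSpace α] [MeasurableSpace β] {P : Measure Ω} [IsProbabilityMeasure P]
    {X : Ω → α} {Y : Ω → β} (hXY : IndepFun X Y P) (hX : AEMeasurable X P)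
    (hY : AEMeasurable Y P) {F : α × β → ℝ≥0∞} (hF : Measurable F) :
    ∫⁻ ω, F (X ω, Y ω) ∂P = ∫⁻ ω', ∫⁻ ω, F (X ω, Y ω') ∂P ∂P := by
  rw [← lintegral_map' hF.aemeasurable (hX.prodMk hY), hXY.map_prod_eq_prod_map_map hX hY,
    lintegral_prod_symm' _ hF, lintegral_map' hF.lintegral_prod_left'.aemeasurable hY]
  refine lintegral_congr fun ω' => ?_
  rw [lintegral_map' (by fun_prop) hX]

lemma ProbabilityTheory.iIndepFun.lintegral_prod_eq_prod_lintegral {Ω ι : Type*}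
    [Countable ι] [MeasurableSpace Ω] {P : Measure Ω} {X : ι → Ω → ℝ≥0∞} (hX : iIndepFun X P)
    (hm : ∀ i, AEMeasurable (X i) P) (s : Finset ι) :
    ∫⁻ ω, ∏ i ∈ s, X i ω ∂P = ∏ i ∈ s, ∫⁻ ω, X i ω ∂P := by
  have hX' : iIndepFun (fun i => (hm i).mk (X i)) P := hX.congr fun i => (hm i).ae_eq_mk
  have hae : ∀ᵐ ω ∂P, ∀ i, X i ω = (hm i).mk (X i) ω := ae_all_iff.2 fun i => (hm i).ae_eq_mk
  calc
    _ = ∫⁻ ω, ∏ i ∈ s, (hm i).mk (X i) ω ∂P := by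
      refine lintegral_congr_ae ?_
      filter_upwards [hae] with ω hω
      simp [hω]
    _ = ∏ i ∈ s, ∫⁻ ω, (hm i).mk (X i) ω ∂P :=
      lintegral_prod_eq_prod_lintegral_of_indepFun s _ hX' fun i => (hm i).measurable_mk
    _ = _ := Finset.prod_congr rfl fun i _ => (lintegral_congr_ae (hm i).ae_eq_mk).symm

lemma tendsto_lintegral_expNeg {Ω : Type*} [MeasurableSpace Ω] {P : Measure Ω}
    [IsProbabilityMeasure P] {X : ℕ → Ω → ℝ≥0∞} {Y : Ω → ℝ≥0∞}
    (hX : ∀ n, AEMeasurable (X n) P)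
    (h : ∀ ω, Filter.Tendsto (fun n => X n ω) Filter.atTop (nhds (Y ω))) :
    Filter.Tendsto (fun n => ∫⁻ ω, expNeg (X n ω) ∂P) Filter.atTop
      (nhds (∫⁻ ω, expNeg (Y ω) ∂P)) :=
  tendsto_lintegral_of_dominated_convergence' 1
    (fun n => measurable_expNeg.comp_aemeasurable (hX n))
    (fun n => Filter.Eventually.of_forall fun ω => expNeg_le_one _) (by simp)
    (Filter.Eventually.of_forall fun ω => (continuous_expNeg.tendsto _).comp (h ω))

/-- Independence gives the finite products, dominated convergence the limit. Writing the product
through `negLog` makes it `expNeg` of a sum, hence later of an integral against the counting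
measure. -/
lemma lintegral_expNeg_tsum_exponential {Ω : Type*} [MeasurableSpace Ω] {P : Measure Ω}
    [IsProbabilityMeasure P] {h : ℕ → Ω → ℝ} (hh : ∀ i, HasLaw (h i) (expMeasure 1) P)
    (hind : iIndepFun h P) (a : ℕ → ℝ≥0∞) :
    ∫⁻ ω, expNeg (∑' i, ENNReal.ofReal (h i ω) * a i) ∂P =
      expNeg (∑' i, negLog (1 + a i)⁻¹) := by
  have hm (i : ℕ) : Measurable fun t : ℝ => expNeg (ENNReal.ofReal t * a i) :=
    measurable_expNeg.comp (by fun_prop)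
  have hterm (i : ℕ) :
      ∫⁻ ω, expNeg (ENNReal.ofReal (h i ω) * a i) ∂P = expNeg (negLog (1 + a i)⁻¹) := by
    rw [expNeg_negLog (by simp), ← lintegral_expNeg_mul_expMeasure_one, ← (hh i).map_eq,
      lintegral_map' (hm i).aemeasurable (hh i).aemeasurable]
  have hfin (n : ℕ) : ∫⁻ ω, expNeg (∑ i ∈ Finset.range n, ENNReal.ofReal (h i ω) * a i) ∂P =
      expNeg (∑ i ∈ Finset.range n, negLog (1 + a i)⁻¹) := by
    simp_rw [expNeg_sum, ← hterm]
    exact (hind.comp _ hm).lintegral_prod_eq_prod_lintegral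
      (fun i => (hm i).comp_aemeasurable (hh i).aemeasurable) _
  refine tendsto_nhds_unique (tendsto_lintegral_expNeg (P := P)
    (X := fun n ω => ∑ i ∈ Finset.range n, ENNReal.ofReal (h i ω) * a i) (fun n => ?_)
    fun ω => ENNReal.tendsto_nat_tsum _) ?_
  · exact Finset.aemeasurable_fun_sum _ fun i _ =>
      ((hh i).aemeasurable.ennreal_ofReal).mul_const _
  · simp_rw [hfin]
    exact (continuous_expNeg.tendsto _).comp (ENNReal.tendsto_nat_tsum _)

/-! ### The Laplace functional of a Poisson point process -/

/-- The level set of `0` is dropped because it may have infinite intensity, where the Poisson axioms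
say nothing. -/
lemma MeasureTheory.SimpleFunc.map_lintegral_of_zero {E : Type*} [MeasurableSpace E]
    (f : SimpleFunc E ℝ≥0∞) {g : ℝ≥0∞ → ℝ≥0∞} (hg : g 0 = 0) (μ : Measure E) :
    ∫⁻ x, g (f x) ∂μ = ∑ v : {v // v ∈ f.range.erase 0}, g v * μ (f ⁻¹' {(v : ℝ≥0∞)}) := by
  rw [Finset.sum_coe_sort (f.range.erase 0) fun v => g v * μ (f ⁻¹' {v}),
    Finset.sum_erase _ (by simp [hg]), ← SimpleFunc.map_lintegral,
    ← SimpleFunc.lintegral_eq_lintegral]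
  rfl

lemma MeasureTheory.SimpleFunc.lintegral_eq_sum_erase {E : Type*} [MeasurableSpace E]
    (f : SimpleFunc E ℝ≥0∞) (μ : Measure E) :
    ∫⁻ x, f x ∂μ = ∑ v : {v // v ∈ f.range.erase 0}, v * μ (f ⁻¹' {(v : ℝ≥0∞)}) :=
  f.map_lintegral_of_zero (g := id) rfl μ

namespace IsPoissonPointProcess

variable {Ω E : Type*} [MeasurableSpace Ω] [MeasurableSpace E] {N : Ω → Measure E}
  {Λ : Measure E} {P : Measure Ω}

lemma lintegral_expNeg_mul_count (hN : IsPoissonPointProcess N Λ P) {B : Set E}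
    (hB : MeasurableSet B) (hΛ : Λ B ≠ ∞) (v : ℝ≥0∞) :
    ∫⁻ ω, expNeg (v * N ω B) ∂P = expNeg ((1 - expNeg v) * Λ B) := by
  have hlaw := hN.hasLaw_count B hB hΛ
  have hm : Measurable fun x : ℝ≥0∞ => expNeg (v * x) := measurable_expNeg.comp (by fun_prop)
  rw [← lintegral_map' hm.aemeasurable hlaw.aemeasurable, hlaw.map_eq,
    lintegral_map hm .of_discrete, lintegral_expNeg_mul_poissonMeasure, ENNReal.coe_toNNReal hΛ]

lemma aemeasurable_lintegral_simpleFunc (hN : IsPoissonPointProcess N Λ P)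
    {f : SimpleFunc E ℝ≥0∞} (hf : f.FinMeasSupp Λ) :
    AEMeasurable (fun ω => ∫⁻ x, f x ∂N ω) P := by
  simp_rw [f.lintegral_eq_sum_erase]
  exact Finset.aemeasurable_fun_sum _ fun v _ =>
    (hN.hasLaw_count _ (f.measurableSet_preimage _) (hf.meas_preimage_singleton_ne_zero
      (Finset.ne_of_mem_erase v.2)).ne).aemeasurable.const_mul _

/-- The nonzero level sets are disjoint with finite intensity, so their counts are independent
Poisson variables and the transform factorises. -/
lemma lintegral_expNeg_simpleFunc (hN : IsPoissonPointProcess N Λ P)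
    {f : SimpleFunc E ℝ≥0∞} (hf : f.FinMeasSupp Λ) :
    ∫⁻ ω, expNeg (∫⁻ x, f x ∂N ω) ∂P = expNeg (∫⁻ x, (1 - expNeg (f x)) ∂Λ) := by
  rw [f.map_lintegral_of_zero (g := fun v => 1 - expNeg v) (by simp)]
  simp_rw [f.lintegral_eq_sum_erase]
  set e := (f.range.erase 0).equivFin
  have hfin (v : {v // v ∈ f.range.erase 0}) : Λ (f ⁻¹' {(v : ℝ≥0∞)}) ≠ ∞ :=
    (hf.meas_preimage_singleton_ne_zero (Finset.ne_of_mem_erase v.2)).ne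
  have hmeas (v : {v // v ∈ f.range.erase 0}) : MeasurableSet (f ⁻¹' {(v : ℝ≥0∞)}) :=
    f.measurableSet_preimage _
  have hind := hN.iIndepFun_count _ (fun j => f ⁻¹' {((e.symm j : {v // v ∈ f.range.erase 0}) :
    ℝ≥0∞)}) (fun j => hmeas _) (fun j => hfin _) (fun j k hjk => by
      refine Disjoint.preimage _ (Set.disjoint_singleton.2 fun h => hjk ?_)
      exact e.symm.injective (Subtype.ext h))
  have hm (v : ℝ≥0∞) : Measurable fun x : ℝ≥0∞ => expNeg (v * x) :=
    measurable_expNeg.comp (by fun_prop)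
  simp_rw [← e.symm.sum_comp, expNeg_sum,
    ← hN.lintegral_expNeg_mul_count (hmeas _) (hfin _)]
  exact (hind.comp (fun j x => expNeg (e.symm j * x)) fun j => hm _).lintegral_prod_eq_prod_lintegral
    (fun j => (hm _).comp_aemeasurable (hN.hasLaw_count _ (hmeas _) (hfin _)).aemeasurable) _

theorem laplace_functional [IsProbabilityMeasure P] [SigmaFinite Λ]
    (hN : IsPoissonPointProcess N Λ P) {f : E → ℝ≥0∞} (hf : Measurable f) :
    ∫⁻ ω, expNeg (∫⁻ x, f x ∂N ω) ∂P = expNeg (∫⁻ x, (1 - expNeg (f x)) ∂Λ) := by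
  -- Truncating to the spanning sets gives finite-intensity support while keeping monotone
  -- convergence to `f`.
  set F : ℕ → SimpleFunc E ℝ≥0∞ := fun n => (SimpleFunc.eapprox f n).restrict (spanningSets Λ n)
  have hS (n : ℕ) : MeasurableSet (spanningSets Λ n) := measurableSet_spanningSets Λ n
  have hFapply (n : ℕ) (x : E) :
      F n x = (spanningSets Λ n).indicator (SimpleFunc.eapprox f n) x :=
    SimpleFunc.restrict_apply _ (hS n) x
  have hsupp (n : ℕ) : (F n).FinMeasSupp Λ := by
    rw [SimpleFunc.finMeasSupp_iff_support]
    refine (measure_mono ?_).trans_lt (measure_spanningSets_lt_top Λ n)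
    rw [SimpleFunc.coe_restrict _ (hS n)]
    exact Set.support_indicator_subset
  have hmono (x : E) : Monotone fun n => F n x := fun m n hmn => by
    simp only [hFapply]
    exact (Set.indicator_le_indicator (SimpleFunc.monotone_eapprox f hmn x)).trans
      (Set.indicator_le_indicator_of_subset (monotone_spanningSets Λ hmn) (fun _ => zero_le) x)
  have hlim (x : E) : Filter.Tendsto (fun n => F n x) Filter.atTop (nhds (f x)) := by
    refine (SimpleFunc.tendsto_eapprox hf x).congr' ?_
    filter_upwards [Filter.eventually_ge_atTop (spanningSetsIndex Λ x)] with n hn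
    rw [hFapply, Set.indicator_of_mem (monotone_spanningSets Λ hn (mem_spanningSetsIndex Λ x))]
  refine tendsto_nhds_unique (tendsto_lintegral_expNeg (P := P)
    (X := fun n ω => ∫⁻ x, F n x ∂N ω)
    (fun n => hN.aemeasurable_lintegral_simpleFunc (hsupp n)) fun ω => ?_) ?_
  · exact lintegral_tendsto_of_tendsto_of_monotone (fun n => (F n).measurable.aemeasurable)
      (.of_forall hmono) (.of_forall hlim)
  · simp_rw [hN.lintegral_expNeg_simpleFunc (hsupp _)]
    refine (continuous_expNeg.tendsto _).comp (lintegral_tendsto_of_tendsto_of_monotone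
      (fun n => ?_) (.of_forall fun x m n hmn => ?_) (.of_forall fun x => ?_))
    · exact ((measurable_expNeg.comp (F n).measurable).const_sub 1).aemeasurable
    · exact tsub_le_tsub_left (expNeg_antitone (hmono x hmn)) 1
    · exact ENNReal.Tendsto.sub tendsto_const_nhds
        ((continuous_expNeg.tendsto _).comp (hlim x)) (.inl ENNReal.one_ne_top)

end IsPoissonPointProcess

/-! ### The path-loss integral over the plane -/

lemma lintegral_exp_neg_mul_norm_rpow_plane {η b : ℝ} (hη : 1 ≤ η) (hb : 0 < b) :
    ∫⁻ y : Plane, ENNReal.ofReal (Real.exp (-b * ‖y‖ ^ η)) =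
      ENNReal.ofReal (Real.pi * b ^ (-2 / η) * Real.Gamma (2 / η + 1)) := by
  have hint := Complex.integral_exp_neg_mul_rpow hη hb
  have hpos : 0 < Real.pi * b ^ (-2 / η) * Real.Gamma (2 / η + 1) := by
    have := Real.Gamma_pos_of_pos (s := 2 / η + 1) (by positivity)
    positivity
  -- A non-integrable function would have Bochner integral `0`, so the nonzero value proves
  -- integrability.
  have hI : Integrable fun z : ℂ => Real.exp (-b * ‖z‖ ^ η) :=
    Integrable.of_integral_ne_zero (by rw [hint]; exact hpos.ne')
  rw [← hint, ofReal_integral_eq_lintegral_ofReal hI (.of_forall fun z => (Real.exp_pos _).le),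
    ← Complex.orthonormalBasisOneI.measurePreserving_repr.lintegral_comp (by fun_prop)]
  simp

lemma lintegral_exp_neg_mul_rpow_Ioi {a r : ℝ} (ha : 0 < a) (hr : 0 < r) :
    ∫⁻ t in Set.Ioi (0 : ℝ), ENNReal.ofReal (t ^ (a - 1) * Real.exp (-(r * t))) =
      ENNReal.ofReal ((1 / r) ^ a * Real.Gamma a) := by
  have hint := Real.integral_rpow_mul_exp_neg_mul_Ioi ha hr
  have hpos : 0 < (1 / r) ^ a * Real.Gamma a := by
    have := Real.Gamma_pos_of_pos ha
    positivity
  have hI : IntegrableOn (fun t : ℝ => t ^ (a - 1) * Real.exp (-(r * t))) (Set.Ioi 0) :=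
    Integrable.of_integral_ne_zero (by rw [hint]; exact hpos.ne')
  rw [← hint, ofReal_integral_eq_lintegral_ofReal hI]
  filter_upwards [self_mem_ae_restrict measurableSet_Ioi] with t ht
  exact mul_nonneg (Real.rpow_nonneg (le_of_lt ht) _) (Real.exp_pos _).le

/-- With `r = ‖y‖^η`, both sides are `s / (s + r) = s ∫ exp (-(s + r) t) dt`. The exponential
separates `s` from `r`, so after Tonelli the plane integral is a Gamma integral. -/
lemma one_sub_inv_one_add_pathLoss {η s : ℝ} (hs : 0 < s) {y : Plane} (hy : y ≠ 0) :
    1 - (1 + ENNReal.ofReal s * ‖y‖ₑ ^ (-η))⁻¹ =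
      ∫⁻ t in Set.Ioi (0 : ℝ), ENNReal.ofReal (s * Real.exp (-(s * t))) *
        ENNReal.ofReal (Real.exp (-t * ‖y‖ ^ η)) := by
  have hy' : 0 < ‖y‖ := norm_pos_iff.2 hy
  have hr : 0 < ‖y‖ ^ η := Real.rpow_pos_of_pos hy' η
  calc
    _ = ENNReal.ofReal (s * (Real.exp (-(s + ‖y‖ ^ η) * 0) / (s + ‖y‖ ^ η))) := by
      rw [← ofReal_norm, ENNReal.ofReal_rpow_of_pos hy', ← ENNReal.ofReal_mul hs.le,
        ← ENNReal.ofReal_one, ← ENNReal.ofReal_add zero_le_one (by positivity),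
        ← ENNReal.ofReal_inv_of_pos (by positivity), ← ENNReal.ofReal_sub _ (by positivity),
        Real.rpow_neg hy'.le, mul_zero, Real.exp_zero]
      congr 1
      field_simp
      ring
    _ = _ := by
      rw [ENNReal.ofReal_mul hs.le, ← lintegral_exp_neg_mul_Ioi (by positivity),
        ← lintegral_const_mul _ (by fun_prop)]
      refine lintegral_congr fun t => ?_
      rw [ENNReal.ofReal_mul hs.le, mul_assoc, ← ENNReal.ofReal_mul (Real.exp_pos _).le,
        ← Real.exp_add]
      ring_nf

lemma lintegral_one_sub_inv_one_add_pathLoss {η s : ℝ} (hη : 2 < η) (hs : 0 < s) :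
    ∫⁻ y : Plane, (1 - (1 + ENNReal.ofReal s * ‖y‖ₑ ^ (-η))⁻¹) =
      ENNReal.ofReal (2 * Real.pi ^ 2 * s ^ (2 / η) / (η * Real.sin (2 * Real.pi / η))) := by
  have hη0 : 0 < η := by linarith
  -- Here `η > 2` enters: it makes `t^(-2/η)` integrable at `0`.
  have ha : 0 < 1 - 2 / η := by rw [sub_pos, div_lt_one hη0]; exact hη
  calc
    _ = ∫⁻ y : Plane, ∫⁻ t in Set.Ioi (0 : ℝ), ENNReal.ofReal (s * Real.exp (-(s * t))) *
          ENNReal.ofReal (Real.exp (-t * ‖y‖ ^ η)) := by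
      refine lintegral_congr_ae ?_
      filter_upwards [Measure.ae_ne volume (0 : Plane)] with y hy
      exact one_sub_inv_one_add_pathLoss hs hy
    _ = ∫⁻ t in Set.Ioi (0 : ℝ), ∫⁻ y : Plane, ENNReal.ofReal (s * Real.exp (-(s * t))) *
          ENNReal.ofReal (Real.exp (-t * ‖y‖ ^ η)) :=
      lintegral_lintegral_swap (by fun_prop)
    _ = ∫⁻ t in Set.Ioi (0 : ℝ), ENNReal.ofReal (s * (Real.pi * Real.Gamma (2 / η + 1))) *
          ENNReal.ofReal (t ^ (1 - 2 / η - 1) * Real.exp (-(s * t))) := by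
      refine setLIntegral_congr_fun measurableSet_Ioi fun t ht => ?_
      have ht : 0 < t := ht
      have hG := Real.Gamma_pos_of_pos (s := 2 / η + 1) (by positivity)
      rw [lintegral_const_mul _ (by fun_prop),
        lintegral_exp_neg_mul_norm_rpow_plane (by linarith) ht,
        ← ENNReal.ofReal_mul (by positivity), ← ENNReal.ofReal_mul (by positivity)]
      congr 1
      rw [show 1 - 2 / η - 1 = -2 / η by ring]
      ring
    _ = _ := by
      have hG := Real.Gamma_pos_of_pos (s := 2 / η + 1) (by positivity)
      rw [lintegral_const_mul _ (by fun_prop), lintegral_exp_neg_mul_rpow_Ioi ha hs,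
        ← ENNReal.ofReal_mul (by positivity)]
      congr 1
      -- Reflection produces the sine, once `Γ (2/η + 1)` is reduced to `Γ (2/η)`.
      have hrefl := Real.Gamma_mul_Gamma_one_sub (2 / η)
      have hsp : s * (1 / s) ^ (1 - 2 / η) = s ^ (2 / η) := by
        rw [one_div, Real.inv_rpow hs.le, ← Real.rpow_neg hs.le]
        nth_rw 1 [← Real.rpow_one s]
        rw [← Real.rpow_add hs]
        ring_nf
      rw [Real.Gamma_add_one (by positivity)]
      calc
        _ = (s * (1 / s) ^ (1 - 2 / η)) * Real.pi * (2 / η) *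
              (Real.Gamma (2 / η) * Real.Gamma (1 - 2 / η)) := by ring
        _ = _ := by
          rw [hrefl, hsp, show Real.pi * (2 / η) = 2 * Real.pi / η by ring]
          ring

/-! ### The feedback success probability -/

lemma ae_eq_zero_poissonMeasure_zero : ∀ᵐ k ∂poissonMeasure 0, k = 0 := by
  rw [poissonMeasure, Measure.ae_sum_iff]
  intro n
  rcases eq_or_ne n 0 with rfl | hn
  · simp [ae_dirac_eq]
  · simp [hn]

/-- A Poisson count of mean zero vanishes almost surely. Hence excluding `y₀` from the interference
costs nothing. -/
lemma IsPoissonPointProcess.ae_ne {Ω E : Type*} [MeasurableSpace Ω] [MeasurableSpace E]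
    [MeasurableSingletonClass E] {P : Measure Ω} {Λ : Measure E} {y : ℕ → Ω → E}
    (hN : IsPoissonPointProcess (countingProcess y) Λ P) {z : E} (hz : Λ {z} = 0) :
    ∀ᵐ ω ∂P, ∀ i, y i ω ≠ z := by
  have hlaw := hN.hasLaw_count {z} (measurableSet_singleton z) (by simp [hz])
  have h0 : ∀ᵐ ω ∂P, countingProcess y ω {z} = 0 := by
    rw [hlaw.ae_iff (p := fun x => x = 0) (measurableSet_setOfPred.1 (measurableSet_singleton 0)), hz,
      ae_map_iff (p := fun x : ℝ≥0∞ => x = 0) .of_discrete (measurableSet_singleton 0)]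
    filter_upwards [ae_eq_zero_poissonMeasure_zero] with k hk
    simp [hk]
  filter_upwards [h0] with ω hω i hi
  rw [countingProcess, Measure.sum_apply _ (measurableSet_singleton z), ENNReal.tsum_eq_zero] at hω
  simpa [hi] using hω i

lemma lintegral_expNeg_shotNoise {Ω E : Type*} [MeasurableSpace Ω] [MeasurableSpace E]
    {P : Measure Ω} [IsProbabilityMeasure P] {Λ : Measure E} [SigmaFinite Λ]
    {y : ℕ → Ω → E} (hy : ∀ i, Measurable (y i))
    (hN : IsPoissonPointProcess (countingProcess y) Λ P)
    {h : ℕ → Ω → ℝ} (hh : ∀ i, HasLaw (h i) (expMeasure 1) P) (hind : iIndepFun h P)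
    (hind_loc : IndepFun (fun ω i => h i ω) (fun ω i => y i ω) P)
    {w : E → ℝ≥0∞} (hw : Measurable w) :
    ∫⁻ ω, expNeg (∑' i, ENNReal.ofReal (h i ω) * w (y i ω)) ∂P =
      expNeg (∫⁻ x, (1 - (1 + w x)⁻¹) ∂Λ) := by
  have hF : Measurable fun q : (ℕ → ℝ) × (ℕ → E) =>
      expNeg (∑' i, ENNReal.ofReal (q.1 i) * w (q.2 i)) :=
    measurable_expNeg.comp (Measurable.tsum fun i => by fun_prop)
  have hg : Measurable fun x => negLog (1 + w x)⁻¹ := measurable_negLog.comp (by fun_prop)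
  rw [hind_loc.lintegral_comp_prodMk (aemeasurable_pi_lambda _ fun i => (hh i).aemeasurable)
    (measurable_pi_lambda _ hy).aemeasurable hF]
  simp_rw [lintegral_expNeg_tsum_exponential hh hind]
  -- Applied to `-log (1 / (1 + w))`, whose integral against the counting measure is the sum left by
  -- the gains.
  have hL := hN.laplace_functional hg
  simp_rw [countingProcess, lintegral_sum_measure, lintegral_dirac' _ hg,
    expNeg_negLog (show (1 + w _)⁻¹ ≤ 1 by simp)] at hL
  exact hL

lemma measure_le_ofReal_of_indepFun {Ω α : Type*} [MeasurableSpace Ω] [MeasurableSpace α]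
    {P : Measure Ω} [IsProbabilityMeasure P] {h₀ : Ω → ℝ} (hh₀ : HasLaw h₀ (expMeasure 1) P)
    {X : Ω → α} (hX : AEMeasurable X P) (hind : IndepFun h₀ X P) {J : α → ℝ≥0∞}
    (hJ : Measurable J) :
    P {ω | J (X ω) ≤ ENNReal.ofReal (h₀ ω)} = ∫⁻ ω, expNeg (J (X ω)) ∂P := by
  have hS : MeasurableSet {q : ℝ × α | J q.2 ≤ ENNReal.ofReal q.1} :=
    measurableSet_le (by fun_prop) (by fun_prop)
  have hS' (x : ℝ≥0∞) : MeasurableSet {t : ℝ | x ≤ ENNReal.ofReal t} :=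
    measurableSet_le (by fun_prop) (by fun_prop)
  have h1 := hind.lintegral_comp_prodMk hh₀.aemeasurable hX
    ((measurable_one (α := ℝ≥0∞)).indicator hS)
  have hnull : NullMeasurableSet {ω | J (X ω) ≤ ENNReal.ofReal (h₀ ω)} P :=
    (hh₀.aemeasurable.prodMk hX).nullMeasurableSet_preimage hS
  calc
    _ = ∫⁻ ω, {q : ℝ × α | J q.2 ≤ ENNReal.ofReal q.1}.indicator 1 (h₀ ω, X ω) ∂P := by
      rw [← lintegral_indicator_one₀ hnull]
      rfl
    _ = _ := h1
    _ = ∫⁻ ω', P {ω | J (X ω') ≤ ENNReal.ofReal (h₀ ω)} ∂P := by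
      refine lintegral_congr fun ω' => ?_
      exact lintegral_indicator_one₀
        (hh₀.aemeasurable.nullMeasurableSet_preimage (hS' (J (X ω'))))
    _ = _ := by
      refine lintegral_congr fun ω' => ?_
      rw [hh₀.measure_eq (p := fun t => J (X ω') ≤ ENNReal.ofReal t) (hS' _),
        expMeasure_one_le_ofReal]

lemma feedbackInterference_eq_tsum {Ω : Type*} {η p : ℝ} {x₀ y₀ : Plane} {y : ℕ → Ω → Plane}
    {h : ℕ → Ω → ℝ} {ω : Ω} (hω : ∀ i, y i ω ≠ y₀) :
    feedbackInterference η p x₀ y₀ y h ω = ∑' i, receivedPower η p (h i ω) (y i ω) x₀ :=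
  (Equiv.subtypeUnivEquiv hω).tsum_eq fun i => receivedPower η p (h i ω) (y i ω) x₀

lemma ofReal_le_feedbackSIR_iff {Ω : Type*} {η p θ R₀ : ℝ} (hp : 0 < p) (hθ : 0 < θ)
    (hR₀ : 0 < R₀) {y₀ : Plane} (hy₀ : ‖y₀ - 0‖ = R₀) {y : ℕ → Ω → Plane} {h₀ : Ω → ℝ}
    {h : ℕ → Ω → ℝ} {ω : Ω} (hω : ∀ i, y i ω ≠ y₀) (hpos : 0 < h₀ ω) :
    ENNReal.ofReal θ ≤ feedbackSIR η p 0 y₀ y h₀ h ω ↔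
      ∑' i, ENNReal.ofReal (h i ω) * (ENNReal.ofReal (θ * R₀ ^ η) * ‖y i ω‖ₑ ^ (-η)) ≤
        ENNReal.ofReal (h₀ ω) := by
  have hR : 0 < R₀ ^ η := Real.rpow_pos_of_pos hR₀ η
  set T := ∑' i, ENNReal.ofReal (h i ω) * ‖y i ω‖ₑ ^ (-η)
  have hI : ∑' i, receivedPower η p (h i ω) (y i ω) 0 = ENNReal.ofReal p * T := by
    rw [← ENNReal.tsum_mul_left]
    refine tsum_congr fun i => ?_
    rw [receivedPower, sub_zero, ENNReal.ofReal_mul hp.le, mul_assoc]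
  have hJ : ∑' i, ENNReal.ofReal (h i ω) * (ENNReal.ofReal (θ * R₀ ^ η) * ‖y i ω‖ₑ ^ (-η)) =
      ENNReal.ofReal (θ * R₀ ^ η) * T := by
    rw [← ENNReal.tsum_mul_left]
    exact tsum_congr fun i => mul_left_comm _ _ _
  have hS : receivedPower η p (h₀ ω) y₀ 0 = ENNReal.ofReal (p * h₀ ω * (R₀ ^ η)⁻¹) := by
    rw [receivedPower, ← ofReal_norm, hy₀, ENNReal.ofReal_rpow_of_pos hR₀,
      ← ENNReal.ofReal_mul (by positivity), Real.rpow_neg hR₀.le]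
  have hS0 : ENNReal.ofReal (p * h₀ ω * (R₀ ^ η)⁻¹) ≠ 0 := by
    rw [Ne, ENNReal.ofReal_eq_zero, not_le]
    positivity
  have hc0 : ENNReal.ofReal (p * (R₀ ^ η)⁻¹) ≠ 0 := by
    rw [Ne, ENNReal.ofReal_eq_zero, not_le]
    positivity
  -- A nonzero finite signal allows clearing the denominator even if the interference is `0` or `∞`;
  -- `h₀ ω > 0` excludes `0 / 0 = 0`. Then the common factor `p R₀^(-η)` cancels.
  rw [feedbackSIR, feedbackInterference_eq_tsum hω, hI, hJ, hS,
    ENNReal.le_div_iff_mul_le (.inr hS0) (.inr ENNReal.ofReal_ne_top),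
    ← ENNReal.mul_le_mul_iff_right hc0 ENNReal.ofReal_ne_top (b := _ * T),
    ← mul_assoc, ← mul_assoc, ← ENNReal.ofReal_mul hθ.le, ← ENNReal.ofReal_mul (by positivity),
    ← ENNReal.ofReal_mul (by positivity)]
  rw [show p * (R₀ ^ η)⁻¹ * (θ * R₀ ^ η) = θ * p by field_simp,
    show p * h₀ ω * (R₀ ^ η)⁻¹ = p * (R₀ ^ η)⁻¹ * h₀ ω by ring]

theorem mainTheorem3 {Ω : Type*} [MeasurableSpace Ω] (P : Measure Ω) [IsProbabilityMeasure P]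
    (η lam p θ R₀ : ℝ) (hη : 2 < η) (hlam : 0 < lam) (hp : 0 < p) (hθ : 0 < θ) (hR₀ : 0 < R₀)
    -- the typical transmitter is at the origin, its paired receiver `y₀` is at distance `R₀`
    (y₀ : Plane) (hy₀ : ‖y₀ - 0‖ = R₀)
    -- the interfering receivers form a homogeneous Poisson point process of intensity `lam`
    (y : ℕ → Ω → Plane) (hy : ∀ i, Measurable (y i))
    (hPPP : IsPoissonPointProcess (countingProcess y) (ENNReal.ofReal lam • volume) P)
    -- Rayleigh fading: all power gains are exponential with mean one
    (h₀ : Ω → ℝ) (h : ℕ → Ω → ℝ)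
    (hh₀ : HasLaw h₀ (expMeasure 1) P) (hh : ∀ i, HasLaw (h i) (expMeasure 1) P)
    -- the gains are independent of each other and of the locations
    (hind : iIndepFun h P)
    (hind_loc : IndepFun (fun ω i => h i ω) (fun ω i => y i ω) P)
    (hind₀ : IndepFun h₀ (fun ω => ((fun i => h i ω), (fun i => y i ω))) P) :
    feedbackSuccessProbability P η p θ 0 y₀ y h₀ h =
      Real.exp (-2 * Real.pi ^ 2 * lam * R₀ ^ 2 * θ ^ (2 / η) /
        (η * Real.sin (2 * Real.pi / η))) := by 
  have hy₀m : (ENNReal.ofReal lam • (volume : Measure Plane)) {y₀} = 0 := by simp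
  have hw : Measurable fun x : Plane => ENNReal.ofReal (θ * R₀ ^ η) * ‖x‖ₑ ^ (-η) := by fun_prop
  have hs : 0 < θ * R₀ ^ η := mul_pos hθ (Real.rpow_pos_of_pos hR₀ η)
  have hσ : SigmaFinite (ENNReal.ofReal lam • (volume : Measure Plane)) :=
    inferInstanceAs (SigmaFinite (Real.toNNReal lam • (volume : Measure Plane)))
  have hJ : Measurable fun q : (ℕ → ℝ) × (ℕ → Plane) => ∑' i, ENNReal.ofReal (q.1 i) *
      (ENNReal.ofReal (θ * R₀ ^ η) * ‖q.2 i‖ₑ ^ (-η)) :=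
    Measurable.tsum fun i => by fun_prop
  have hXm : AEMeasurable (fun ω => ((fun i => h i ω), (fun i => y i ω))) P :=
    (aemeasurable_pi_lambda _ fun i => (hh i).aemeasurable).prodMk
      (measurable_pi_lambda _ hy).aemeasurable
  have hpos : ∀ᵐ ω ∂P, 0 < h₀ ω :=
    (hh₀.ae_iff (measurableSet_setOfPred.1 measurableSet_Ioi)).2 ae_pos_expMeasure_one
  have hsin : 0 < Real.sin (2 * Real.pi / η) := by
    have hη0 : 0 < η := by linarith
    refine Real.sin_pos_of_pos_of_lt_pi (by positivity) ?_
    rw [div_lt_iff₀ hη0]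
    nlinarith [Real.pi_pos]
  have hevent : P {ω | ENNReal.ofReal θ ≤ feedbackSIR η p 0 y₀ y h₀ h ω} =
      P {ω | ∑' i, ENNReal.ofReal (h i ω) * (ENNReal.ofReal (θ * R₀ ^ η) * ‖y i ω‖ₑ ^ (-η)) ≤
        ENNReal.ofReal (h₀ ω)} := by
    refine measure_congr ?_
    filter_upwards [hPPP.ae_ne hy₀m, hpos] with ω hω hω₀
    exact propext (ofReal_le_feedbackSIR_iff hp hθ hR₀ hy₀ hω hω₀)
  rw [feedbackSuccessProbability, measureReal_def, hevent,
    measure_le_ofReal_of_indepFun hh₀ hXm hind₀ hJ,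
    lintegral_expNeg_shotNoise hy hPPP hh hind hind_loc hw, lintegral_smul_measure,
    lintegral_one_sub_inv_one_add_pathLoss hη hs, smul_eq_mul, ← ENNReal.ofReal_mul hlam.le,
    expNeg_ofReal (by positivity), ENNReal.toReal_ofReal (Real.exp_pos _).le,
    Real.mul_rpow hθ.le (by positivity), ← Real.rpow_mul hR₀.le,
    mul_div_cancel₀ _ (by linarith : η ≠ 0), Real.rpow_two]
  congr 1
  ring
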